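/- For $n\ge 1$ write $N=2^n$. For functions $f,g:\{0,1\}^n\to\{\pm1\}$ and a permutation $\pi$ of $\{0,1\}^n$, let $U_{f,g,\pi}=U_\pi U_g H^{\otimes n}U_f$ be the unitary on $n$ qubits, where $U_f|x\rangle=f(x)|x\rangle$, $U_g|x\rangle=g(x)|x\rangle$, $U_\pi|x\rangle=|\pi(x)\rangle$ and $H$ is the one-qubit Hadamard matrix. For $s,t\in\mathbb N$ let $$\rho_{\mathrm{uni}_{s,t}}=\frac{1}{N(N-1)\cdots(N-st+1)}\sum_{z}\ \sum_{\sigma\in S_t^s}|z\rangle\langle\sigma(z)|,$$ where $z=(z_{j,i})_{j\in[s],\,i\in[t]}$ ranges over all $st$-tuples of pairwise distinct elements of $\{0,1\}^n$, $S_t^s=S_t\times\cdots\times S_t$ is the group of permutations of $[s]\times[t]$ that preserve each block $\{j\}\times[t]$, and $\sigma(z)_{j,i}=z_{\sigma(j,i)}$ (if $st>N$ there is no such $z$, and $\rho_{\mathrm{uni}_{s,t}}$ is read as $0$). Let $\|A\|_1=\operatorname{Tr}\sqrt{AA^\dagger}$ denote the trace norm. There is an absolute constant $C$ such that for all $n\ge1$,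 all $s,t\in\mathbb N$ (in particular for $s,t$ that are polynomials in $n$) and all orthonormal $n$-qubit states $|\psi^{(1)}\rangle,\dots,|\psi^{(s)}\rangle\in\mathbb C^{\{0,1\}^n}$, $$\left\|\ \mathop{\mathbb E}_{f,g,\pi}\left[U_{f,g,\pi}^{\otimes st}\left(\bigotimes_{j\in[s]}\bigl(|\psi^{(j)}\rangle\langle\psi^{(j)}|\bigr)^{\otimes t}\right)\bigl(U_{f,g,\pi}^\dagger\bigr)^{\otimes st}\right]-\rho_{\mathrm{uni}_{s,t}}\right\|_1\le C\,\frac{s^6t^4n^2}{N},$$ where $f,g$ are independent uniformly random functions $\{0,1\}^n\to\{\pm1\}$ and $\pi$ is an independent uniformly random permutation of $\{0,1\}^n$. -/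

import Mathlib

open scoped Matrix BigOperators

noncomputable section

namespace OrthPRU

/-- The trace norm `‖A‖₁ = Tr √(A A†)` of a square complex matrix, i.e. the sum of its singular
values; the square root is that of the continuous functional calculus of Hermitian matrices. -/
def traceNorm {ι : Type*} [Fintype ι] [DecidableEq ι] (A : Matrix ι ι ℂ) : ℝ :=
  (cfc Real.sqrt (A * Aᴴ)).trace.re

/-- The tensor product `⨂ k, A k` of matrices, in the product basis. -/
def tensor {κ α : Type*} [Fintype κ] (A : κ → Matrix α α ℂ) : Matrix (κ → α) (κ → α) ℂ :=
  Matrix.of fun x y => ∏ k, A k (x k) (y k)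

/-- Bit strings of length `n`, the labels of the computational basis of `n` qubits. -/
abbrev Bits (n : ℕ) : Type := Fin n → Bool

/-- The pure state `|ψ⟩⟨ψ|` as a matrix. -/
def ketbra {n : ℕ} (ψ : EuclideanSpace ℂ (Bits n)) : Matrix (Bits n) (Bits n) ℂ :=
  Matrix.of fun x y => ψ x * star (ψ y)

/-- The one-qubit Hadamard matrix. -/
def hadamard : Matrix Bool Bool ℂ :=
  Matrix.of fun a b => (if a && b then -1 else 1) / (Real.sqrt 2 : ℂ)

/-- The phase unitary `|x⟩ ↦ f x |x⟩`, where `ℤˣ = {1, -1}`. -/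
def phaseU {n : ℕ} (f : Bits n → ℤˣ) : Matrix (Bits n) (Bits n) ℂ :=
  Matrix.diagonal fun x => (((f x : ℤˣ) : ℤ) : ℂ)

/-- The permutation unitary `|x⟩ ↦ |π x⟩`. -/
def permU {n : ℕ} (π : Equiv.Perm (Bits n)) : Matrix (Bits n) (Bits n) ℂ :=
  ∑ x, Matrix.single (π x) x 1

/-- The unitary `U_π U_g H^{⊗n} U_f`. -/
def circuitU {n : ℕ} (f g : Bits n → ℤˣ) (π : Equiv.Perm (Bits n)) :
    Matrix (Bits n) (Bits n) ℂ :=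
  permU π * phaseU g * tensor (fun _ : Fin n => hadamard) * phaseU f

/-- The `t`-fold copies of `s` states: `⨂_{j ∈ [s]} (|ψ j⟩⟨ψ j|)^{⊗ t}`. The `s * t` registers are
indexed by pairs `(j, i)`. -/
def inputState {n s : ℕ} (t : ℕ) (ψ : Fin s → EuclideanSpace ℂ (Bits n)) :
    Matrix (Fin s × Fin t → Bits n) (Fin s × Fin t → Bits n) ℂ :=
  tensor fun p : Fin s × Fin t => ketbra (ψ p.1)

/-- The expectation over independent uniform `f`, `g`, `π` of
`U_{f,g,π}^{⊗ st} (⨂_j (|ψ j⟩⟨ψ j|)^{⊗ t}) (U_{f,g,π}^†)^{⊗ st}`. -/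
def outputState {n s : ℕ} (t : ℕ) (ψ : Fin s → EuclideanSpace ℂ (Bits n)) :
    Matrix (Fin s × Fin t → Bits n) (Fin s × Fin t → Bits n) ℂ :=
  𝔼 f : Bits n → ℤˣ, 𝔼 g : Bits n → ℤˣ, 𝔼 π : Equiv.Perm (Bits n),
    tensor (fun _ : Fin s × Fin t => circuitU f g π) * inputState t ψ *
      tensor (fun _ : Fin s × Fin t => (circuitU f g π)ᴴ)

/-- `ρ_uni = (1 / N(N-1)⋯(N-st+1)) ∑_{z, σ} |z⟩⟨σ(z)|` with `N = 2 ^ n`. Here `z` ranges over the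
`st`-tuples of pairwise distinct `n`-bit strings, `σ` over the block-preserving permutations
`S_t × ⋯ × S_t` of the index set `[s] × [t]`, and `σ(z)_{(j, i)} = z_{σ(j, i)}`. -/
def rhoUni (n s t : ℕ) : Matrix (Fin s × Fin t → Bits n) (Fin s × Fin t → Bits n) ℂ :=
  (1 / ((2 ^ n).descFactorial (s * t) : ℂ)) •
    ∑ z : (Fin s × Fin t) ↪ Bits n, ∑ σ : Fin s → Equiv.Perm (Fin t),
      Matrix.single (z : Fin s × Fin t → Bits n) (fun p => z (Equiv.prodCongrRight σ p)) 1

end OrthPRU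

end

/-!
Fix `f` and write `φ j` for the state `H^{⊗n} U_f |ψ j⟩`. Averaging over `g` kills the entry
`|x⟩⟨y|`, for a tuple `x` of distinct strings, unless `y` is a permutation of `x`. Averaging over
`π` makes the surviving entries depend only on that permutation, through the overlap of two product
vectors `⨂ φ (l p)` and `⨂ φ (k p)` restricted to tuples of distinct strings. Without the
restriction these overlaps are `0` or `1` by orthonormality; removing the collisions changes them
by powers of the largest squared amplitude of the `φ j`, so the average is close to `ρ_uni` when
that amplitude is small. Each amplitude of `φ j` is a randomly signed sum of numbers with total
square `1 / 2 ^ n`, so sub-Gaussian concentration over `f` bounds the largest squared amplitude by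
`O(n / 2 ^ n)` on average.
-/

noncomputable section

namespace OrthPRU

section TraceNorm

open scoped ComplexOrder MatrixOrder Matrix.Norms.L2Operator

variable {ι : Type*} [Fintype ι] [DecidableEq ι]

lemma exists_contraction_mul_eq_sqrt (A : Matrix ι ι ℂ) :
    ∃ W : Matrix ι ι ℂ, ‖W‖ ≤ 1 ∧ A * W = cfc Real.sqrt (A * Aᴴ) ∧
      cfc Real.sqrt (A * Aᴴ) * Wᴴ = A := by
  set M := A * Aᴴ with hM
  have hM0 : 0 ≤ M := (Matrix.posSemidef_self_mul_conjTranspose A).nonneg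
  have hc (f : ℝ → ℝ) : ContinuousOn f (spectrum ℝ M) := Matrix.finite_real_spectrum.continuousOn f
  set T := cfc (fun x : ℝ => (√x)⁻¹) M
  set P := cfc (fun x : ℝ => √x * (√x)⁻¹) M
  have hTstar : Tᴴ = T := cfc_predicate (R := ℝ) _ M
  have hST : cfc Real.sqrt M * T = P := (cfc_mul _ _ M (hc _) (hc _)).symm
  have hMT : M * T = cfc Real.sqrt M := by
    conv_lhs => enter [1]; rw [← cfc_id ℝ M]
    rw [← cfc_mul _ _ M (hc _) (hc _)]
    exact cfc_congr fun x _ => by rw [id, ← div_eq_mul_inv, Real.div_sqrt]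
  have hPM : P * M = M := by
    conv_lhs => enter [2]; rw [← cfc_id ℝ M]
    rw [← cfc_mul _ _ M (hc _) (hc _)]
    conv_rhs => rw [← cfc_id ℝ M]
    refine cfc_congr fun x hx => ?_
    rcases (spectrum_nonneg_of_nonneg hM0 hx).eq_or_lt with rfl | h
    · simp
    · simp [Real.sqrt_ne_zero'.2 h]
  have hPA : P * A = A := by
    rw [← sub_eq_zero, ← Matrix.one_mul A, ← Matrix.mul_assoc, ← Matrix.sub_mul,
      ← Matrix.mul_self_mul_conjTranspose_eq_zero, Matrix.sub_mul, Matrix.mul_one, ← hM,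
      hPM, Matrix.one_mul, sub_self]
  have hW : (Aᴴ * T)ᴴ = T * A := by
    rw [Matrix.conjTranspose_mul, hTstar, Matrix.conjTranspose_conjTranspose]
  refine ⟨Aᴴ * T, ?_, by rw [← Matrix.mul_assoc, hMT], by rw [hW, ← Matrix.mul_assoc, hST, hPA]⟩
  have hWW : (Aᴴ * T)ᴴ * (Aᴴ * T) = P := by
    rw [hW, Matrix.mul_assoc, ← Matrix.mul_assoc A, hMT, ← hST, (cfc_commute_cfc _ _ M).eq]
  have hP1 : ‖P‖ ≤ 1 := norm_cfc_le zero_le_one fun x _ => by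
    rcases eq_or_ne (√x) 0 with h | h <;> simp [h]
  rw [← hWW, Matrix.l2_opNorm_conjTranspose_mul_self] at hP1
  exact abs_le_one_iff_mul_self_le_one.2 hP1 |>.trans' (le_abs_self _)

lemma norm_dotProduct_mulVec_le (v w : ι → ℂ) (U : Matrix ι ι ℂ) :
    ‖v ⬝ᵥ U *ᵥ w‖ ≤ ‖U‖ * (‖WithLp.toLp 2 v‖ * ‖WithLp.toLp 2 w‖) := by
  have h : v ⬝ᵥ U *ᵥ w = inner ℂ (WithLp.toLp 2 (star v)) (WithLp.toLp 2 (U *ᵥ w)) := by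
    rw [EuclideanSpace.inner_toLp_toLp, star_star, dotProduct_comm]
  have hstar : ‖WithLp.toLp 2 (star v)‖ = ‖WithLp.toLp 2 v‖ := by simp [EuclideanSpace.norm_eq]
  calc ‖v ⬝ᵥ U *ᵥ w‖ ≤ ‖WithLp.toLp 2 v‖ * ‖WithLp.toLp 2 (U *ᵥ w)‖ := by
        rw [h, ← hstar]; exact norm_inner_le_norm _ _
    _ ≤ ‖WithLp.toLp 2 v‖ * (‖U‖ * ‖WithLp.toLp 2 w‖) := by
        gcongr; exact U.l2_opNorm_mulVec (WithLp.toLp 2 w)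
    _ = _ := by ring

lemma norm_trace_mul_le_of_posSemidef {S : Matrix ι ι ℂ} (hS : S.PosSemidef) (V : Matrix ι ι ℂ) :
    ‖(S * V).trace‖ ≤ ‖V‖ * S.trace.re := by
  obtain ⟨B, rfl⟩ := CStarAlgebra.nonneg_iff_eq_star_mul_self.1 hS.nonneg
  have hrow (W : Matrix ι ι ℂ) :
      (star B * B * W).trace = ∑ i, B i ⬝ᵥ W *ᵥ star (B i) := by
    rw [Matrix.mul_assoc, Matrix.trace_mul_comm, Matrix.mul_assoc]
    rfl
  have hnorm (i : ι) : ‖WithLp.toLp 2 (B i)‖ * ‖WithLp.toLp 2 (star (B i))‖ =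
      (B i ⬝ᵥ star (B i)).re := by
    have h : (B i ⬝ᵥ star (B i)).re = ∑ x, ‖B i x‖ ^ 2 := by
      simp [dotProduct, Complex.mul_conj', ← Complex.ofReal_pow]
    simp only [EuclideanSpace.norm_eq, Pi.star_apply, norm_star]
    rw [h, Real.mul_self_sqrt (by positivity)]
  calc ‖(star B * B * V).trace‖
      ≤ ∑ i, ‖V‖ * (B i ⬝ᵥ star (B i)).re := by
        rw [hrow]
        exact norm_sum_le_of_le _ fun i _ => (norm_dotProduct_mulVec_le _ _ V).trans_eq
          (by rw [hnorm])
    _ = ‖V‖ * (star B * B).trace.re := by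
        rw [← Finset.mul_sum, ← Complex.re_sum, ← mul_one (star B * B), hrow]
        simp only [Matrix.one_mulVec]

theorem traceNorm_le_iff {A : Matrix ι ι ℂ} {b : ℝ} :
    traceNorm A ≤ b ↔ ∀ U : Matrix ι ι ℂ, ‖U‖ ≤ 1 → ‖(A * U).trace‖ ≤ b := by
  obtain ⟨W, hW, hAW, hSW⟩ := exists_contraction_mul_eq_sqrt A
  refine ⟨fun h U hU => le_trans ?_ h, fun h => ?_⟩
  · have hS : (cfc Real.sqrt (A * Aᴴ)).PosSemidef :=
      Matrix.nonneg_iff_posSemidef.1 (cfc_nonneg fun x _ => Real.sqrt_nonneg x)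
    have hWU : ‖Wᴴ * U‖ ≤ 1 := (Matrix.l2_opNorm_mul _ _).trans
      (by rw [Matrix.l2_opNorm_conjTranspose]; exact mul_le_one₀ hW (norm_nonneg _) hU)
    rw [← hSW, Matrix.mul_assoc, hSW]
    exact (norm_trace_mul_le_of_posSemidef hS _).trans
      (mul_le_of_le_one_left (Complex.nonneg_iff.1 hS.trace_nonneg).1 hWU)
  · have := h W hW
    rw [hAW] at this
    exact (Complex.re_le_norm _).trans this

lemma norm_trace_mul_le {U : Matrix ι ι ℂ} (A : Matrix ι ι ℂ) (hU : ‖U‖ ≤ 1) :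
    ‖(A * U).trace‖ ≤ traceNorm A :=
  traceNorm_le_iff.1 le_rfl U hU

lemma traceNorm_add_le (A B : Matrix ι ι ℂ) :
    traceNorm (A + B) ≤ traceNorm A + traceNorm B := traceNorm_le_iff.2 fun U hU => by
  rw [Matrix.add_mul, Matrix.trace_add]
  exact (norm_add_le _ _).trans (add_le_add (norm_trace_mul_le A hU) (norm_trace_mul_le B hU))

lemma traceNorm_sub_le (A B : Matrix ι ι ℂ) :
    traceNorm (A - B) ≤ traceNorm A + traceNorm B := traceNorm_le_iff.2 fun U hU => by
  rw [Matrix.sub_mul, Matrix.trace_sub]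
  exact (norm_sub_le _ _).trans (add_le_add (norm_trace_mul_le A hU) (norm_trace_mul_le B hU))

lemma traceNorm_smul_le (c : ℂ) (A : Matrix ι ι ℂ) :
    traceNorm (c • A) ≤ ‖c‖ * traceNorm A := traceNorm_le_iff.2 fun U hU => by
  rw [Matrix.smul_mul, Matrix.trace_smul, norm_smul]
  exact mul_le_mul_of_nonneg_left (norm_trace_mul_le A hU) (norm_nonneg c)

lemma traceNorm_sum_le {τ : Type*} (S : Finset τ) (A : τ → Matrix ι ι ℂ) :
    traceNorm (∑ i ∈ S, A i) ≤ ∑ i ∈ S, traceNorm (A i) := traceNorm_le_iff.2 fun U hU => by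
  rw [Finset.sum_mul, Matrix.trace_sum]
  exact norm_sum_le_of_le _ fun i _ => norm_trace_mul_le (A i) hU

omit [DecidableEq ι] in
lemma trace_expect {τ : Type*} [Fintype τ] (A : τ → Matrix ι ι ℂ) :
    (𝔼 i, A i).trace = 𝔼 i, (A i).trace :=
  map_expect (Matrix.traceLinearMap ι ℚ≥0 ℂ) _ _

lemma traceNorm_expect_le {τ : Type*} [Fintype τ] (A : τ → Matrix ι ι ℂ) :
    traceNorm (𝔼 i, A i) ≤ 𝔼 i, traceNorm (A i) := traceNorm_le_iff.2 fun U hU => by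
  rw [Finset.expect_mul, trace_expect]
  exact (RCLike.norm_expect_le (K := ℂ)).trans
    (Finset.expect_le_expect fun i _ => norm_trace_mul_le (A i) hU)

lemma traceNorm_vecMulVec_le (v w : ι → ℂ) :
    traceNorm (Matrix.vecMulVec v w) ≤ ‖WithLp.toLp 2 v‖ * ‖WithLp.toLp 2 w‖ :=
  traceNorm_le_iff.2 fun U hU => by
    rw [Matrix.vecMulVec_mul, Matrix.trace_vecMulVec, dotProduct_comm, ← Matrix.dotProduct_mulVec,
      mul_comm ‖WithLp.toLp 2 v‖]
    exact (norm_dotProduct_mulVec_le w v U).trans (mul_le_of_le_one_left (by positivity) hU)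

lemma traceNorm_of_posSemidef {A : Matrix ι ι ℂ} (hA : A.PosSemidef) :
    traceNorm A = A.trace.re := by
  have hsa : IsSelfAdjoint A := hA.isHermitian
  have hA2 : A * Aᴴ = cfc (fun x : ℝ => x ^ 2) A := by
    rw [cfc_pow_id (R := ℝ) A 2, pow_two, hA.isHermitian.eq]
  rw [traceNorm, hA2, ← cfc_comp' Real.sqrt (fun x : ℝ => x ^ 2) A,
    cfc_congr (f := fun x : ℝ => √(x ^ 2)) (g := id) fun x hx =>
      Real.sqrt_sq (spectrum_nonneg_of_nonneg hA.nonneg hx), cfc_id ℝ A]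

omit [DecidableEq ι] in
lemma norm_toLp_indicator (p : ι → Prop) [DecidablePred p] :
    ‖WithLp.toLp 2 (fun x => if p x then (1 : ℂ) else 0)‖ = √(Finset.univ.filter p).card := by
  simp [EuclideanSpace.norm_eq, apply_ite]

lemma traceNorm_of_key_eq_le {K : Type*} [DecidableEq K] (S : Finset ι) (F G : ι → K) :
    traceNorm (Matrix.of fun x y => if x ∈ S ∧ y ∈ S ∧ F x = G y then (1 : ℂ) else 0) ≤ S.card := by
  set keys := S.image F ∪ S.image G
  have hsum : (Matrix.of fun x y => if x ∈ S ∧ y ∈ S ∧ F x = G y then (1 : ℂ) else 0) =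
      ∑ k ∈ keys, Matrix.vecMulVec (fun x => if x ∈ S ∧ F x = k then (1 : ℂ) else 0)
        (fun y => if y ∈ S ∧ G y = k then (1 : ℂ) else 0) := by
    ext x y
    simp only [Matrix.of_apply, Matrix.sum_apply, Matrix.vecMulVec_apply]
    by_cases hx : x ∈ S
    · have hFx : F x ∈ keys := Finset.mem_union_left _ (Finset.mem_image_of_mem F hx)
      simp only [hx, true_and, ite_mul, one_mul, zero_mul, Finset.sum_ite_eq, hFx, if_true,
        eq_comm (a := G y)]
    · simp [hx]
  have hcard (H : ι → K) (hH : S.image H ⊆ keys) :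
      ∑ k ∈ keys, ((Finset.univ.filter fun x => x ∈ S ∧ H x = k).card : ℝ) = S.card := by
    rw [Finset.card_eq_sum_card_fiberwise fun x hx => hH (Finset.mem_image_of_mem H hx)]
    simp only [Finset.filter_and, Finset.filter_mem_eq_inter, Finset.univ_inter,
      Finset.inter_filter, Finset.inter_univ, Nat.cast_sum]
  rw [hsum]
  refine (traceNorm_sum_le _ _).trans ?_
  calc _ ≤ ∑ k ∈ keys, √(Finset.univ.filter fun x => x ∈ S ∧ F x = k).card *
          √(Finset.univ.filter fun y => y ∈ S ∧ G y = k).card :=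
        Finset.sum_le_sum fun k _ => (traceNorm_vecMulVec_le _ _).trans_eq
          (by rw [norm_toLp_indicator, norm_toLp_indicator])
    _ ≤ √S.card * √S.card := by
        rw [← hcard F Finset.subset_union_left]
        nth_rewrite 2 [hcard F Finset.subset_union_left]
        rw [← hcard G Finset.subset_union_right]
        exact Real.sum_sqrt_mul_sqrt_le _ (fun _ => by positivity) fun _ => by positivity
    _ = S.card := Real.mul_self_sqrt (by positivity)

end TraceNorm

section InjSum

variable {ι α : Type*} [Fintype ι] [Fintype α]

/-- The sum of `∏ a, u a (x a)` over tuples `x` of pairwise distinct elements, as a multilinear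
form in the functions `u a`. -/
def injSum : MultilinearMap ℂ (fun _ : ι => α → ℂ) ℂ :=
  ∑ x : ι ↪ α, (MultilinearMap.mkPiAlgebra ℂ ι ℂ).compLinearMap fun a => LinearMap.proj (x a)

lemma injSum_apply (u : ι → α → ℂ) : injSum u = ∑ x : ι ↪ α, ∏ a, u a (x a) := by
  simp [injSum]

lemma sum_compl_range [DecidableEq α] (x : ι ↪ α) (v : α → ℂ) :
    ∑ y : ↥(Set.range x)ᶜ, v y = ∑ y, v y - ∑ b, v (x b) := by
  rw [eq_sub_iff_add_eq, add_comm, ← Finset.sum_map Finset.univ x v,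
    ← Finset.sum_add_sum_compl (Finset.univ.map x) v]
  congr 1
  exact (Finset.sum_subtype _ (by simp) v).symm

lemma norm_injSum_le_one {u : ι → α → ℂ} (hu : ∀ a, ∑ y, ‖u a y‖ ≤ 1) : ‖injSum u‖ ≤ 1 := by
  classical
  rw [injSum_apply]
  calc ‖∑ x : ι ↪ α, ∏ a, u a (x a)‖
      ≤ ∑ x : ι ↪ α, ∏ a, ‖u a (x a)‖ := norm_sum_le_of_le _ fun x _ => (norm_prod _ _).le
    _ = ∑ x ∈ Finset.univ.map ⟨fun x : ι ↪ α => (x : ι → α), DFunLike.coe_injective⟩,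
          ∏ a, ‖u a (x a)‖ := by rw [Finset.sum_map]; rfl
    _ ≤ ∑ x : ι → α, ∏ a, ‖u a (x a)‖ := Finset.sum_le_univ_sum_of_nonneg fun x => by positivity
    _ = ∏ a, ∑ y, ‖u a y‖ := by rw [Finset.prod_univ_sum, Fintype.piFinset_univ]
    _ ≤ 1 := Finset.prod_le_one (fun a _ => by positivity) fun a _ => hu a

variable [DecidableEq ι]

-- Given the other entries `x`, the entry at `a` runs over `α` except for the values `x b`, and an
-- excluded value `x b` merges the factors at `a` and `b`.
lemma injSum_eq_sub (u : ι → α → ℂ) (a : ι) :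
    injSum u = (∑ y, u a y) * injSum (fun b : {b // b ≠ a} => u b) -
      ∑ b : {b // b ≠ a}, injSum (Function.update (fun c : {c // c ≠ a} => u c) b (u a * u b)) := by
  classical
  let e : (ι ↪ α) ≃ Σ x : {b // b ≠ a} ↪ α, ↥(Set.range x)ᶜ :=
    (Equiv.embeddingCongr (Equiv.optionSubtypeNe a).symm (Equiv.refl α)).trans
      (Function.Embedding.optionEmbeddingEquiv _ α)
  have hsplit : injSum u = ∑ x : {b // b ≠ a} ↪ α,
      (∑ y : ↥(Set.range x)ᶜ, u a y) * ∏ c : {c // c ≠ a}, u c (x c) := by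
    rw [injSum_apply, ← e.symm.sum_comp, Fintype.sum_sigma]
    simp only [Finset.sum_mul, Fintype.prod_eq_mul_prod_subtype_ne _ a]
    refine Finset.sum_congr rfl fun x _ => Finset.sum_congr rfl fun y _ => ?_
    have he (b : ι) :
        e.symm ⟨x, y⟩ b = Option.elim' (y : α) x ((Equiv.optionSubtypeNe a).symm b) := rfl
    have hx (c : {c // c ≠ a}) : e.symm ⟨x, y⟩ c = x c := by
      rw [he, Equiv.optionSubtypeNe_symm_of_ne c.2, Option.elim'_some]
    have hy : e.symm ⟨x, y⟩ a = y := by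
      rw [he, Equiv.optionSubtypeNe_symm_self, Option.elim'_none]
    simp only [hx, hy]
  have hmerge (x : {b // b ≠ a} ↪ α) (b : {b // b ≠ a}) :
      ∏ c, Function.update (fun c : {c // c ≠ a} => u c) b (u a * u b) c (x c) =
        u a (x b) * ∏ c : {c // c ≠ a}, u c (x c) := by
    rw [Fintype.prod_eq_mul_prod_compl b, Fintype.prod_eq_mul_prod_compl b, Function.update_self,
      Pi.mul_apply, mul_assoc]
    congr 2
    refine Finset.prod_congr rfl fun c hc => ?_
    rw [Function.update_of_ne (by simpa using hc)]
  rw [hsplit]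
  simp only [injSum_apply, hmerge, sum_compl_range, sub_mul]
  rw [Finset.sum_sub_distrib, Finset.mul_sum, Finset.sum_comm]
  simp only [Finset.sum_mul]

lemma norm_injSum_update_le (u : ι → α → ℂ) (b : ι) (v : α → ℂ) [DecidableEq α] {B : ℝ}
    (hB : ∀ y, ‖injSum (Function.update u b (Pi.single y 1))‖ ≤ B) :
    ‖injSum (Function.update u b v)‖ ≤ (∑ y, ‖v y‖) * B := by
  have hlin : injSum (Function.update u b v) =
      ∑ y, v y * injSum (Function.update u b (Pi.single y 1)) := by
    have := LinearMap.pi_apply_eq_sum_univ (injSum.toLinearMap u b) v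
    simp only [MultilinearMap.toLinearMap_apply, smul_eq_mul] at this
    rw [this]
    refine Finset.sum_congr rfl fun y _ => ?_
    congr 4 with z
    simp only [Pi.single_apply, eq_comm]
  rw [hlin, Finset.sum_mul]
  exact norm_sum_le_of_le _ fun y _ => (norm_mul _ _).trans_le (by gcongr; exact hB y)

lemma norm_injSum_sub_le [DecidableEq α] {u : ι → α → ℂ} {δ B : ℝ} (a : ι) (hδ : 0 ≤ δ)
    (hB₀ : 0 ≤ B) (hu : ∀ b, ∑ y, ‖u b y‖ ≤ 1) (ha : ∀ y, ‖u a y‖ ≤ δ)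
    (hB : ∀ (b : {b // b ≠ a}) (y : α),
      ‖injSum (Function.update (fun c : {c // c ≠ a} => u c) b (Pi.single y 1))‖ ≤ B) :
    ‖injSum u - (∑ y, u a y) * injSum (fun b : {b // b ≠ a} => u b)‖ ≤
      Fintype.card {b // b ≠ a} * (δ * B) := by
  have hmerged (b : ι) : ∑ y, ‖(u a * u b) y‖ ≤ δ :=
    calc ∑ y, ‖(u a * u b) y‖ ≤ ∑ y, δ * ‖u b y‖ := by
          gcongr with y; rw [Pi.mul_apply, norm_mul]; gcongr; exact ha y
      _ ≤ δ := by rw [← Finset.mul_sum]; exact mul_le_of_le_one_right hδ (hu b)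
  rw [injSum_eq_sub u a, sub_sub_cancel_left, norm_neg]
  refine (norm_sum_le_of_le _ fun b _ => (norm_injSum_update_le _ b _ (hB b)).trans
    (mul_le_mul_of_nonneg_right (hmerged b) hB₀)).trans_eq ?_
  rw [Finset.sum_const, Finset.card_univ, nsmul_eq_mul]

omit [Fintype ι] in
lemma sum_norm_update_single_le_one [DecidableEq α] {u : ι → α → ℂ} (hu : ∀ a, ∑ y, ‖u a y‖ ≤ 1)
    (b a : ι) (z : α) : ∑ y, ‖Function.update u b (Pi.single z 1) a y‖ ≤ 1 := by
  rcases eq_or_ne a b with rfl | hab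
  · simp [Pi.single_apply, apply_ite]
  · simpa only [Function.update_of_ne hab] using hu a

lemma card_subtype_ne_add_one (a : ι) : Fintype.card {b // b ≠ a} + 1 = Fintype.card ι := by
  rw [← Fintype.card_option, Fintype.card_congr (Equiv.optionSubtypeNe a)]

omit [DecidableEq ι] in
lemma norm_injSum_sub_prod_le {δ : ℝ} (hδ : 0 ≤ δ) {u : ι → α → ℂ} (hu : ∀ a, ∑ y, ‖u a y‖ ≤ 1)
    (hsup : ∀ a y, ‖u a y‖ ≤ δ) :
    ‖injSum u - ∏ a, ∑ y, u a y‖ ≤ (Fintype.card ι : ℝ) ^ 2 * δ := by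
  classical
  induction hm : Fintype.card ι generalizing ι with
  | zero =>
    have := Fintype.card_eq_zero_iff.1 hm
    simp [injSum_apply]
  | succ m ih =>
    obtain ⟨a⟩ : Nonempty ι := Fintype.card_pos_iff.1 (by omega)
    have hcard : Fintype.card {b // b ≠ a} = m := by have := card_subtype_ne_add_one a; omega
    have hrest := ih (u := fun b : {b // b ≠ a} => u b) (fun b => hu b) (fun b => hsup b) hcard
    have hmerge := norm_injSum_sub_le (B := 1) a hδ zero_le_one hu (hsup a) fun b y =>
      norm_injSum_le_one fun c =>
        sum_norm_update_single_le_one (u := fun c : {c // c ≠ a} => u c) (fun c => hu c) b c y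
    have hsum : ‖∑ y, u a y‖ ≤ 1 := (norm_sum_le _ _).trans (hu a)
    have hprod := Fintype.prod_eq_mul_prod_subtype_ne (fun b => ∑ y, u b y) a
    calc ‖injSum u - ∏ a, ∑ y, u a y‖
        ≤ ‖injSum u - (∑ y, u a y) * injSum (fun b : {b // b ≠ a} => u b)‖ +
          ‖(∑ y, u a y) * injSum (fun b : {b // b ≠ a} => u b) - ∏ a, ∑ y, u a y‖ :=
          norm_sub_le_norm_sub_add_norm_sub _ _ _
      _ ≤ m * (δ * 1) + 1 * (m ^ 2 * δ) := by
          rw [hcard] at hmerge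
          rw [hprod, ← mul_sub, norm_mul]
          gcongr
      _ ≤ ((m + 1 : ℕ) : ℝ) ^ 2 * δ := by
          push_cast
          nlinarith [mul_nonneg (Nat.cast_nonneg (α := ℝ) m) hδ]

omit [DecidableEq ι] in
/-- Removing one index of `Z` and merging it into another one loses at most two indices of `Z`
and gains a factor `δ`. -/
lemma norm_injSum_le_pow {δ : ℝ} (hδ : 0 ≤ δ) {m j : ℕ} (hm : Fintype.card ι ≤ m)
    {u : ι → α → ℂ} {Z : Finset ι} (hu : ∀ a, ∑ y, ‖u a y‖ ≤ 1) (hzero : ∀ a ∈ Z, ∑ y, u a y = 0)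
    (hsup : ∀ a ∈ Z, ∀ y, ‖u a y‖ ≤ δ) (hj : 2 * j ≤ Z.card + 1) :
    ‖injSum u‖ ≤ (m * δ) ^ j := by
  classical
  induction j generalizing ι with
  | zero => simpa using norm_injSum_le_one hu
  | succ j ih =>
    obtain ⟨a, ha⟩ : Z.Nonempty := Finset.card_pos.1 (by omega)
    have hcard := card_subtype_ne_add_one a
    have hrest (b : {b // b ≠ a}) (y : α) :
        ‖injSum (Function.update (fun c : {c // c ≠ a} => u c) b (Pi.single y 1))‖ ≤
          (m * δ) ^ j := by
      set Z' := (Z.subtype (· ≠ a)).erase b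
      have hZ' : ∀ c ∈ Z', c ≠ b ∧ c.1 ∈ Z := by simp [Z']
      refine ih (Z := Z') (by omega) (fun c =>
        sum_norm_update_single_le_one (u := fun c : {c // c ≠ a} => u c) (fun c => hu c) b c y)
        (fun c hc => ?_) (fun c hc => ?_) ?_
      · rw [Function.update_of_ne (hZ' c hc).1]
        exact hzero c (hZ' c hc).2
      · rw [Function.update_of_ne (hZ' c hc).1]
        exact hsup c (hZ' c hc).2
      · have h₁ := Finset.pred_card_le_card_erase (s := Z.subtype (· ≠ a)) (a := b)
        rw [Finset.card_subtype, Finset.filter_ne', Finset.card_erase_of_mem ha] at h₁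
        change _ ≤ Z'.card at h₁
        omega
    have hmerge := norm_injSum_sub_le a hδ (by positivity) hu (hsup a ha) hrest
    rw [hzero a ha, zero_mul, sub_zero] at hmerge
    refine hmerge.trans ?_
    rw [pow_succ', ← mul_assoc]
    gcongr
    exact_mod_cast (Nat.le_succ _).trans (hcard.le.trans hm)

end InjSum

section Overlap

variable {α κ Λ : Type*}

/-- The largest probability with which measuring one of the states `φ p` in the computational basis
gives a particular outcome. -/
def maxProb (φ : Λ → EuclideanSpace ℂ α) : ℝ :=
  ⨆ p : Λ × α, ‖φ p.1 p.2‖ ^ 2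

lemma maxProb_nonneg (φ : Λ → EuclideanSpace ℂ α) : 0 ≤ maxProb φ :=
  Real.iSup_nonneg fun _ => by positivity

lemma norm_sq_le_maxProb [Finite α] [Finite Λ] (φ : Λ → EuclideanSpace ℂ α) (j : Λ) (y : α) :
    ‖φ j y‖ ^ 2 ≤ maxProb φ :=
  le_ciSup (Set.finite_range fun p : Λ × α => ‖φ p.1 p.2‖ ^ 2).bddAbove (j, y)

lemma norm_mul_star_le_maxProb [Finite α] [Finite Λ] (φ : Λ → EuclideanSpace ℂ α) (j k : Λ)
    (y : α) : ‖φ j y * star (φ k y)‖ ≤ maxProb φ := by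
  rw [norm_mul, norm_star]
  nlinarith [norm_sq_le_maxProb φ j y, norm_sq_le_maxProb φ k y, sq_nonneg (‖φ j y‖ - ‖φ k y‖)]

lemma sum_prod_ite_le [Fintype κ] [DecidableEq κ] [Fintype Λ] [DecidableEq Λ]
    (l : κ → Λ) {ρ : ℝ} (hρ : 0 ≤ ρ) :
    ∑ k : κ → Λ, ∏ p, (if k p = l p then 1 else ρ) ≤
      (1 + Fintype.card Λ * ρ) ^ Fintype.card κ := by
  have hsum (j : Λ) : ∑ c, (if c = j then 1 else ρ) ≤ 1 + Fintype.card Λ * ρ :=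
    calc ∑ c, (if c = j then 1 else ρ) ≤ ∑ c, ((if c = j then 1 else 0) + ρ) := by
          gcongr with c; split_ifs <;> linarith
      _ = 1 + Fintype.card Λ * ρ := by
          simp [Finset.sum_add_distrib]
  calc ∑ k : κ → Λ, ∏ p, (if k p = l p then 1 else ρ)
      = ∏ p, ∑ c, if c = l p then 1 else ρ := by
        rw [Finset.prod_univ_sum, Fintype.piFinset_univ]
    _ ≤ ∏ _p : κ, (1 + Fintype.card Λ * ρ) := by
        exact Finset.prod_le_prod (fun p _ => Finset.sum_nonneg fun c _ => by positivity)
          fun p _ => hsum (l p)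
    _ = (1 + Fintype.card Λ * ρ) ^ Fintype.card κ := by rw [Finset.prod_const, Finset.card_univ]

lemma one_add_one_div_pow_le_three (m : ℕ) : (1 + 1 / (m : ℝ)) ^ m ≤ 3 := by
  rcases Nat.eq_zero_or_pos m with rfl | hm
  · norm_num
  calc (1 + 1 / (m : ℝ)) ^ m ≤ Real.exp (1 / m) ^ m := by
        gcongr; linarith [Real.add_one_le_exp (1 / (m : ℝ))]
    _ = Real.exp 1 := by rw [← Real.exp_nat_mul]; field_simp
    _ ≤ 3 := by linarith [Real.exp_one_lt_d9]

variable [Fintype α]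

/-- The overlap of the product vectors `⨂ p, φ (l p)` and `⨂ p, φ (k p)` after projecting to the
span of the basis vectors indexed by tuples of pairwise distinct elements. -/
def injOverlap [Fintype κ] (φ : Λ → EuclideanSpace ℂ α) (l k : κ → Λ) : ℂ :=
  injSum fun p y => φ (l p) y * star (φ (k p) y)

lemma sum_norm_mul_star_le (x y : EuclideanSpace ℂ α) :
    ∑ i, ‖x i * star (y i)‖ ≤ ‖x‖ * ‖y‖ := by
  simp only [norm_mul, norm_star, EuclideanSpace.norm_eq]
  exact Real.sum_mul_le_sqrt_mul_sqrt _ _ _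

lemma sum_mul_star_eq_inner (x y : EuclideanSpace ℂ α) :
    ∑ i, x i * star (y i) = inner ℂ y x := by
  rw [PiLp.inner_apply]
  rfl

variable {φ : Λ → EuclideanSpace ℂ α} (hφ : Orthonormal ℂ φ)
include hφ

lemma sum_norm_mul_star_le_one (j k : Λ) : ∑ y, ‖φ j y * star (φ k y)‖ ≤ 1 :=
  (sum_norm_mul_star_le _ _).trans_eq (by rw [hφ.1, hφ.1, mul_one])

variable [Fintype κ]

lemma norm_injOverlap_self_sub_one_le [Finite Λ] (l : κ → Λ) :
    ‖injOverlap φ l l - 1‖ ≤ (Fintype.card κ : ℝ) ^ 2 * maxProb φ := by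
  have h := norm_injSum_sub_prod_le (maxProb_nonneg φ)
    (fun p => sum_norm_mul_star_le_one hφ (l p) (l p))
    fun p => norm_mul_star_le_maxProb φ (l p) (l p)
  simp only [sum_mul_star_eq_inner, inner_self_eq_norm_sq_to_K, hφ.1, RCLike.ofReal_one, one_pow,
    Finset.prod_const_one] at h
  exact h

variable [DecidableEq Λ]

lemma norm_injOverlap_le_pow [Finite Λ] (l k : κ → Λ) {j : ℕ}
    (hj : 2 * j ≤ (Finset.univ.filter fun p => k p ≠ l p).card + 1) :
    ‖injOverlap φ l k‖ ≤ (Fintype.card κ * maxProb φ) ^ j := by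
  refine norm_injSum_le_pow (maxProb_nonneg φ) le_rfl
    (fun p => sum_norm_mul_star_le_one hφ (l p) (k p)) (fun p hp => ?_)
    (fun p _ => norm_mul_star_le_maxProb φ (l p) (k p)) hj
  rw [sum_mul_star_eq_inner, hφ.2 (Finset.mem_filter.1 hp).2]

lemma norm_injOverlap_le_prod [Finite Λ] {ρ : ℝ} (hρ₀ : 0 < ρ) (hρ₁ : ρ ≤ 1) {l k : κ → Λ}
    (hkl : k ≠ l) (hρ : Fintype.card κ * maxProb φ ≤ ρ ^ 2) :
    ‖injOverlap φ l k‖ ≤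
      Fintype.card κ * maxProb φ / ρ ^ 2 * ∏ p, if k p = l p then 1 else ρ := by
  set d := (Finset.univ.filter fun p => k p ≠ l p).card
  set q := Fintype.card κ * maxProb φ
  have hq : 0 ≤ q := mul_nonneg (Nat.cast_nonneg _) (maxProb_nonneg φ)
  have hd_pos : 0 < d := by
    obtain ⟨p, hp⟩ := Function.ne_iff.1 hkl
    exact Finset.card_pos.2 ⟨p, by simpa using hp⟩
  obtain ⟨j, hj, hj'⟩ : ∃ j, 2 * (j + 1) ≤ d + 1 ∧ d ≤ 2 * (j + 1) :=
    ⟨(d + 1) / 2 - 1, by omega, by omega⟩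
  have hprod : (∏ p, if k p = l p then 1 else ρ) = ρ ^ d := by
    rw [Finset.prod_ite, Finset.prod_const_one, one_mul, Finset.prod_const]
  calc ‖injOverlap φ l k‖ ≤ q * q ^ j := by
        rw [← pow_succ']; exact norm_injOverlap_le_pow hφ l k hj
    _ ≤ q * (ρ ^ 2) ^ j := by gcongr
    _ = q / ρ ^ 2 * ρ ^ (2 * (j + 1)) := by rw [mul_add, pow_add, pow_mul]; field_simp
    _ ≤ q / ρ ^ 2 * ∏ p, if k p = l p then 1 else ρ := by
        rw [hprod]
        exact mul_le_mul_of_nonneg_left (pow_le_pow_of_le_one hρ₀.le hρ₁ hj') (by positivity)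

lemma sum_norm_injOverlap_le [Fintype Λ] [DecidableEq κ] (l : κ → Λ)
    (hsmall : (Fintype.card κ : ℝ) ^ 3 * Fintype.card Λ ^ 2 * maxProb φ ≤ 1) :
    ∑ k ∈ Finset.univ.erase l, ‖injOverlap φ l k‖ ≤
      3 * (Fintype.card κ ^ 3 * Fintype.card Λ ^ 2 * maxProb φ) := by
  have hδ := maxProb_nonneg φ
  rcases isEmpty_or_nonempty κ with hκ | ⟨⟨p₀⟩⟩
  · rw [Finset.sum_eq_zero fun k hk =>
      absurd (Subsingleton.elim k l) (Finset.ne_of_mem_erase hk)]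
    positivity
  have hm : (1 : ℝ) ≤ Fintype.card κ := by exact_mod_cast Fintype.card_pos_iff.2 ⟨p₀⟩
  have hs : (1 : ℝ) ≤ Fintype.card Λ := by exact_mod_cast Fintype.card_pos_iff.2 ⟨l p₀⟩
  set m : ℝ := (Fintype.card κ : ℝ)
  set s : ℝ := (Fintype.card Λ : ℝ)
  have hms : 1 ≤ m * s := one_le_mul_of_one_le_of_one_le hm hs
  set ρ : ℝ := 1 / (m * s) with hρ_def
  have hρ₀ : 0 < ρ := by positivity
  have hρ₁ : ρ ≤ 1 := (div_le_one (by positivity)).2 hms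
  have hρ : m * maxProb φ ≤ ρ ^ 2 := by
    rw [hρ_def, div_pow, one_pow, le_div_iff₀ (by positivity)]
    linarith
  have hsρ : s * ρ = 1 / m := by rw [hρ_def]; field_simp
  calc ∑ k ∈ Finset.univ.erase l, ‖injOverlap φ l k‖
      ≤ ∑ k ∈ Finset.univ.erase l,
          m * maxProb φ / ρ ^ 2 * ∏ p, (if k p = l p then 1 else ρ) :=
        Finset.sum_le_sum fun k hk =>
          norm_injOverlap_le_prod hφ hρ₀ hρ₁ (Finset.ne_of_mem_erase hk) hρ
    _ ≤ ∑ k : κ → Λ, m * maxProb φ / ρ ^ 2 * ∏ p, (if k p = l p then 1 else ρ) :=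
        Finset.sum_le_univ_sum_of_nonneg fun k =>
          mul_nonneg (by positivity) (Finset.prod_nonneg fun p _ => by positivity)
    _ ≤ m ^ 3 * s ^ 2 * maxProb φ * (1 + s * ρ) ^ Fintype.card κ := by
        have hcoef : m * maxProb φ / ρ ^ 2 = m ^ 3 * s ^ 2 * maxProb φ := by
          rw [hρ_def]; field_simp
        rw [← Finset.mul_sum, hcoef]
        exact mul_le_mul_of_nonneg_left (sum_prod_ite_le l hρ₀.le) (by positivity)
    _ ≤ 3 * (m ^ 3 * s ^ 2 * maxProb φ) := by
        rw [hsρ, mul_comm (3 : ℝ)]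
        exact mul_le_mul_of_nonneg_left (one_add_one_div_pow_le_three _) (by positivity)

end Overlap

section Averages

variable {α κ : Type*}

lemma exists_perm_eq_comp [Finite κ] {x y : κ → α} (hx : Function.Injective x)
    (h : Set.range x ⊆ Set.range y) : ∃ σ : Equiv.Perm κ, y = x ∘ σ := by
  choose τ hτ using fun p => h ⟨p, rfl⟩
  have hτ_inj : Function.Injective τ := fun p q hpq => hx (by rw [← hτ p, ← hτ q, hpq])
  let e := Equiv.ofBijective τ (Finite.injective_iff_bijective.1 hτ_inj)
  refine ⟨e.symm, funext fun p => ?_⟩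
  rw [Function.comp_apply, ← hτ]
  exact congrArg y (e.apply_symm_apply p).symm

variable [Fintype α] [DecidableEq α] [Fintype κ]

open Classical in
lemma expect_prod_sign_mul_sign {x : κ → α} (hx : Function.Injective x) (y : κ → α) :
    𝔼 g : α → ℤˣ, ∏ p, (((g (x p) * g (y p) : ℤˣ) : ℤ) : ℂ) =
      if ∃ σ : Equiv.Perm κ, y = x ∘ σ then 1 else 0 := by
  let χ : (α → ℤˣ) →* ℂ := ∏ p, ((Int.castRingHom ℂ).toMonoidHom.comp (Units.coeHom ℤ)).comp
    (Pi.evalMonoidHom (fun _ => ℤˣ) (x p) * Pi.evalMonoidHom (fun _ => ℤˣ) (y p))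
  have hχ (g : α → ℤˣ) : ∏ p, (((g (x p) * g (y p) : ℤˣ) : ℤ) : ℂ) = χ g := by
    simp [χ, MonoidHom.finsetProd_apply]
  simp only [hχ]
  split_ifs with h
  · obtain ⟨σ, rfl⟩ := h
    have hone (g : α → ℤˣ) : χ g = 1 := by
      have hσ := Equiv.prod_comp σ fun p => (((g (x p) : ℤˣ) : ℤ) : ℂ)
      rw [← hχ]
      simp only [Units.val_mul, Int.cast_mul, Function.comp_apply, Finset.prod_mul_distrib, hσ]
      rw [← Finset.prod_mul_distrib]
      exact Finset.prod_eq_one fun p _ => by exact_mod_cast Int.units_coe_mul_self (g (x p))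
    simp only [hone, Fintype.expect_const]
  · obtain ⟨p₀, hp₀⟩ : ∃ p, x p ∉ Set.range y := by
      by_contra! hc
      exact h (exists_perm_eq_comp hx (Set.range_subset_iff.2 hc))
    have hχ_ne : χ ≠ 1 := by
      intro hχ_one
      have hflip := DFunLike.congr_fun hχ_one (Pi.mulSingle (x p₀) (-1))
      have hx_ne (p : κ) (hp : p ≠ p₀) : x p ≠ x p₀ := hx.ne hp
      have hy_ne (p : κ) : y p ≠ x p₀ := fun hp => hp₀ ⟨p, hp⟩
      rw [← hχ, Fintype.prod_eq_single p₀ fun p hp => by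
        simp [Pi.mulSingle_eq_of_ne (hx_ne p hp), Pi.mulSingle_eq_of_ne (hy_ne p)]] at hflip
      norm_num [Pi.mulSingle_eq_of_ne (hy_ne p₀)] at hflip
    rw [Fintype.expect_eq_sum_div_card, sum_hom_units_eq_zero χ hχ_ne, zero_div]

lemma expect_perm_comp (F : (κ → α) → ℂ) (x : κ ↪ α) :
    𝔼 π : Equiv.Perm α, F (π ∘ x) = 𝔼 z : κ ↪ α, F z := by
  classical
  have hindep (z : κ ↪ α) :
      𝔼 π : Equiv.Perm α, F (π ∘ z) = 𝔼 π : Equiv.Perm α, F (π ∘ x) := by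
    obtain ⟨τ, hτ⟩ := Equiv.Perm.exists_extending_pair x z x.injective z.injective
    refine Fintype.expect_equiv (Equiv.mulRight τ) _ _ fun π => congrArg F (funext fun p => ?_)
    simp [hτ]
  have hinvariant (π : Equiv.Perm α) : 𝔼 z : κ ↪ α, F (π ∘ z) = 𝔼 z : κ ↪ α, F z :=
    Fintype.expect_equiv (Equiv.embeddingCongr (Equiv.refl κ) π) _ _ fun _ => rfl
  have : Nonempty (κ ↪ α) := ⟨x⟩
  calc 𝔼 π : Equiv.Perm α, F (π ∘ x)
      = 𝔼 z : κ ↪ α, 𝔼 π : Equiv.Perm α, F (π ∘ z) := by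
        simp only [hindep, Fintype.expect_const]
    _ = 𝔼 z : κ ↪ α, F z := by
        rw [Finset.expect_comm]
        simp only [hinvariant, Fintype.expect_const]

end Averages

section LabelMatch

variable {α κ Λ : Type*} [Fintype α] [Fintype κ]

open Classical in
/-- The sum of `|x⟩⟨y|` over the tuples `x`, `y` of distinct elements such that carrying the labels
`k` along `x` and the labels `l` along `y` gives the same labelled set, normalized by the number of
tuples of distinct elements. Equivalently `y = x ∘ σ` for a permutation `σ` with `k ∘ σ = l`; if `l`
labels each register by its block, then `labelMatch α l l` is the state `ρ_uni`. -/
def labelMatch (α : Type*) [Fintype α] (k l : κ → Λ) : Matrix (κ → α) (κ → α) ℂ :=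
  ((Fintype.card α).descFactorial (Fintype.card κ) : ℂ)⁻¹ • Matrix.of fun x y =>
    if Function.Injective x ∧ Function.Injective y ∧
      Set.range (fun p => (x p, k p)) = Set.range (fun p => (y p, l p)) then 1 else 0

lemma labelMatch_apply_comp [DecidableEq (κ → Λ)] (k l : κ → Λ) {x : κ → α}
    (hx : Function.Injective x) (σ : Equiv.Perm κ) :
    labelMatch α k l x (x ∘ σ) =
      if k = l ∘ σ.symm then ((Fintype.card α).descFactorial (Fintype.card κ) : ℂ)⁻¹ else 0 := by
  have hrange : Set.range (fun p => ((x ∘ σ) p, l p)) =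
      Set.range (fun p => (x p, (l ∘ σ.symm) p)) := by
    rw [← σ.surjective.range_comp fun p => (x p, (l ∘ σ.symm) p)]
    simp [Function.comp_def]
  have hlabels : Set.range (fun p => (x p, k p)) = Set.range (fun p => (x p, (l ∘ σ.symm) p)) ↔
      k = l ∘ σ.symm := by
    refine ⟨fun h => funext fun p => ?_, fun h => by rw [h]⟩
    obtain ⟨q, hq⟩ := h.subset ⟨p, rfl⟩
    obtain rfl := hx (Prod.ext_iff.1 hq).1
    exact (Prod.ext_iff.1 hq).2.symm
  simp only [labelMatch, Matrix.smul_apply, Matrix.of_apply, hx, hx.comp σ.injective, true_and,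
    hrange, hlabels, smul_eq_mul, mul_ite, mul_one, mul_zero]

lemma labelMatch_apply_of_not_injective (k l : κ → Λ) {x : κ → α} (hx : ¬ Function.Injective x)
    (y : κ → α) : labelMatch α k l x y = 0 := by
  simp [labelMatch, hx]

lemma labelMatch_apply_of_not_perm (k l : κ → Λ) {x y : κ → α}
    (h : ¬ ∃ σ : Equiv.Perm κ, y = x ∘ σ) : labelMatch α k l x y = 0 := by
  rw [labelMatch, Matrix.smul_apply, Matrix.of_apply, if_neg, smul_zero]
  rintro ⟨hx, -, hrange⟩
  refine h (exists_perm_eq_comp hx ?_)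
  rintro _ ⟨p, rfl⟩
  obtain ⟨q, hq⟩ := hrange.subset ⟨p, rfl⟩
  exact ⟨q, (Prod.ext_iff.1 hq).1⟩

lemma traceNorm_labelMatch_le [DecidableEq α] [DecidableEq κ] (k l : κ → Λ) :
    traceNorm (labelMatch α k l) ≤ 1 := by
  classical
  set N := (Fintype.card α).descFactorial (Fintype.card κ) with hN
  set S : Finset (κ → α) := {x | Function.Injective x}
  have hS : S.card = N := by
    rw [hN, ← Fintype.card_embedding_eq, ← Fintype.card_subtype]
    exact Fintype.card_congr (Equiv.subtypeInjectiveEquivEmbedding κ α)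
  have hlabel : labelMatch α k l = (N : ℂ)⁻¹ • Matrix.of fun x y => if x ∈ S ∧ y ∈ S ∧
      Set.range (fun p => (x p, k p)) = Set.range (fun p => (y p, l p)) then 1 else 0 := by
    ext x y
    simp only [labelMatch, S, Finset.mem_filter_univ, Matrix.smul_apply, Matrix.of_apply]
    congr!
  calc traceNorm (labelMatch α k l) ≤ ‖(N : ℂ)⁻¹‖ * S.card := by
        rw [hlabel]
        exact (traceNorm_smul_le _ _).trans
          (mul_le_mul_of_nonneg_left (traceNorm_of_key_eq_le S _ _) (norm_nonneg _))
    _ = (N : ℝ)⁻¹ * N := by rw [norm_inv, Complex.norm_natCast, hS]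
    _ ≤ 1 := inv_mul_le_one

end LabelMatch

section Twirl

open scoped ComplexOrder

variable {α κ Λ : Type*} [Fintype α] [Fintype κ]

/-- The product vector `⨂ p, φ (l p)` after applying the phase `g` and then the permutation `π` to
each register. -/
def twirlVec (φ : Λ → EuclideanSpace ℂ α) (l : κ → Λ) (g : α → ℤˣ) (π : Equiv.Perm α) :
    (κ → α) → ℂ :=
  fun x => ∏ p, ((g (π.symm (x p)) : ℤ) : ℂ) * φ (l p) (π.symm (x p))

variable [DecidableEq α]

/-- The average over phases `g` and permutations `π` of the pure states `twirlVec φ l g π`. -/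
def twirl (φ : Λ → EuclideanSpace ℂ α) (l : κ → Λ) : Matrix (κ → α) (κ → α) ℂ :=
  𝔼 g : α → ℤˣ, 𝔼 π : Equiv.Perm α,
    Matrix.vecMulVec (twirlVec φ l g π) (star (twirlVec φ l g π))

lemma matrix_expect_apply {ι τ : Type*} [Fintype τ] (A : τ → Matrix ι ι ℂ) (x y : ι) :
    (𝔼 i, A i) x y = 𝔼 i, A i x y :=
  map_expect (Matrix.entryLinearMap ℚ≥0 ℂ x y) _ _

lemma posSemidef_expect {ι τ : Type*} [Fintype τ] {A : τ → Matrix ι ι ℂ}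
    (hA : ∀ i, (A i).PosSemidef) : (𝔼 i, A i).PosSemidef :=
  (Matrix.posSemidef_sum _ fun i _ => hA i).smul (by positivity)

lemma twirl_posSemidef (φ : Λ → EuclideanSpace ℂ α) (l : κ → Λ) : (twirl φ l).PosSemidef :=
  posSemidef_expect fun _ => posSemidef_expect fun _ => Matrix.posSemidef_vecMulVec_self_star _

omit [DecidableEq α] in
lemma sum_norm_sq_twirlVec [DecidableEq κ] {φ : Λ → EuclideanSpace ℂ α} (hφ : ∀ j, ‖φ j‖ = 1)
    (l : κ → Λ) (g : α → ℤˣ) (π : Equiv.Perm α) : ∑ x, ‖twirlVec φ l g π x‖ ^ 2 = 1 := by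
  have hunit (p : κ) : ∑ y, ‖((g (π.symm y) : ℤ) : ℂ) * φ (l p) (π.symm y)‖ ^ 2 = 1 := by
    rw [Equiv.sum_comp π.symm fun y => ‖((g y : ℤ) : ℂ) * φ (l p) y‖ ^ 2]
    have hsign (y : α) : ‖((g y : ℤ) : ℂ)‖ = 1 := by
      rcases Int.units_eq_one_or (g y) with h | h <;> simp [h]
    simp only [norm_mul, hsign, one_mul, ← EuclideanSpace.norm_sq_eq, hφ, one_pow]
  simp only [twirlVec, norm_prod, ← Finset.prod_pow]
  rw [← Fintype.piFinset_univ,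
    ← Finset.prod_univ_sum (f := fun p y => ‖((g (π.symm y) : ℤ) : ℂ) * φ (l p) (π.symm y)‖ ^ 2)]
  exact Finset.prod_eq_one fun p _ => hunit p

lemma trace_twirl [DecidableEq κ] {φ : Λ → EuclideanSpace ℂ α} (hφ : ∀ j, ‖φ j‖ = 1)
    (l : κ → Λ) : (twirl φ l).trace = 1 := by
  have htrace (g : α → ℤˣ) (π : Equiv.Perm α) :
      (Matrix.vecMulVec (twirlVec φ l g π) (star (twirlVec φ l g π))).trace = 1 := by
    have h := sum_norm_sq_twirlVec hφ l g π
    rw [Matrix.trace_vecMulVec, dotProduct]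
    simp only [Pi.star_apply, Complex.star_def, Complex.mul_conj']
    exact_mod_cast h
  simp only [twirl, trace_expect, htrace, Fintype.expect_const]

lemma twirl_apply (φ : Λ → EuclideanSpace ℂ α) (l : κ → Λ) (x y : κ → α) :
    twirl φ l x y = 𝔼 π : Equiv.Perm α,
      (∏ p, φ (l p) (π.symm (x p)) * star (φ (l p) (π.symm (y p)))) *
        𝔼 g : α → ℤˣ, ∏ p, (((g (π.symm (x p)) * g (π.symm (y p)) : ℤˣ) : ℤ) : ℂ) := by
  simp only [twirl, matrix_expect_apply, Matrix.vecMulVec_apply]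
  rw [Finset.expect_comm]
  simp only [Finset.mul_expect, ← Finset.prod_mul_distrib, twirlVec, Pi.star_apply, star_prod]
  refine Finset.expect_congr rfl fun π _ => Finset.expect_congr rfl fun g _ =>
    Finset.prod_congr rfl fun p _ => ?_
  rw [star_mul', star_intCast, Units.val_mul, Int.cast_mul]
  ring

lemma twirl_apply_of_not_perm (φ : Λ → EuclideanSpace ℂ α) (l : κ → Λ) {x y : κ → α}
    (hx : Function.Injective x) (h : ¬ ∃ σ : Equiv.Perm κ, y = x ∘ σ) : twirl φ l x y = 0 := by
  rw [twirl_apply]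
  refine Finset.expect_eq_zero fun π _ => ?_
  have hsign := expect_prod_sign_mul_sign (π.symm.injective.comp hx) (π.symm ∘ y)
  rw [if_neg fun ⟨σ, hσ⟩ => h ⟨σ, π.symm.injective.comp_left hσ⟩] at hsign
  simp only [Function.comp_apply] at hsign
  rw [hsign, mul_zero]

lemma twirl_apply_comp (φ : Λ → EuclideanSpace ℂ α) (l : κ → Λ) {x : κ → α}
    (hx : Function.Injective x) (σ : Equiv.Perm κ) :
    twirl φ l x (x ∘ σ) =
      injOverlap φ l (l ∘ σ.symm) / (Fintype.card α).descFactorial (Fintype.card κ) := by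
  have hsign (π : Equiv.Perm α) :
      𝔼 g : α → ℤˣ, ∏ p, (((g (π.symm (x p)) * g (π.symm ((x ∘ σ) p)) : ℤˣ) : ℤ) : ℂ) = 1 :=
    (expect_prod_sign_mul_sign (π.symm.injective.comp hx) ((π.symm ∘ x) ∘ σ)).trans
      (if_pos ⟨σ, rfl⟩)
  calc twirl φ l x (x ∘ σ)
      = 𝔼 π : Equiv.Perm α, ∏ p, φ (l p) (π.symm (x p)) * star (φ (l p) (π.symm (x (σ p)))) := by
        simp only [twirl_apply, hsign, mul_one]; rfl
    _ = 𝔼 π : Equiv.Perm α, ∏ p, φ (l p) (π (x p)) * star (φ (l p) (π (x (σ p)))) :=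
        Fintype.expect_equiv (Equiv.inv _) _ _ fun _ => rfl
    _ = 𝔼 z : κ ↪ α, ∏ p, φ (l p) (z p) * star (φ (l p) (z (σ p))) :=
        expect_perm_comp (fun z => ∏ p, φ (l p) (z p) * star (φ (l p) (z (σ p)))) ⟨x, hx⟩
    _ = injOverlap φ l (l ∘ σ.symm) / (Fintype.card α).descFactorial (Fintype.card κ) := by
        rw [Fintype.expect_eq_sum_div_card, Fintype.card_embedding_eq, injOverlap, injSum_apply]
        simp only [Finset.prod_mul_distrib, Function.comp_apply]
        congr! 3 with z
        exact Fintype.prod_equiv σ _ _ fun p => by rw [Equiv.symm_apply_apply]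

/-- The part of `twirl` supported on tuples with a collision. -/
def collisionPart (φ : Λ → EuclideanSpace ℂ α) (l : κ → Λ) : Matrix (κ → α) (κ → α) ℂ :=
  Matrix.of fun x y =>
    if Function.Injective x ∨ Function.Injective y then 0 else twirl φ l x y

lemma twirl_eq_collisionPart_add_sum [DecidableEq κ] [Fintype Λ]
    (φ : Λ → EuclideanSpace ℂ α) (l : κ → Λ) :
    twirl φ l = collisionPart φ l + ∑ k : κ → Λ, injOverlap φ l k • labelMatch α k l := by
  classical
  ext x y
  simp only [Matrix.add_apply, Matrix.sum_apply, Matrix.smul_apply, smul_eq_mul, collisionPart,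
    Matrix.of_apply]
  by_cases hx : Function.Injective x
  · rw [if_pos (.inl hx), zero_add]
    by_cases h : ∃ σ : Equiv.Perm κ, y = x ∘ σ
    · obtain ⟨σ, rfl⟩ := h
      simp only [twirl_apply_comp φ l hx, labelMatch_apply_comp _ l hx, mul_ite, mul_zero,
        Finset.sum_ite_eq', Finset.mem_univ, if_true, div_eq_mul_inv]
    · simp only [twirl_apply_of_not_perm φ l hx h, labelMatch_apply_of_not_perm _ l h, mul_zero,
        Finset.sum_const_zero]
  simp only [labelMatch_apply_of_not_injective _ l hx, mul_zero, Finset.sum_const_zero, add_zero]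
  by_cases hy : Function.Injective y
  · have hyx : twirl φ l y x = 0 := twirl_apply_of_not_perm φ l hy fun ⟨σ, hσ⟩ =>
      hx (hσ ▸ hy.comp σ.injective)
    rw [if_pos (.inr hy), ← (twirl_posSemidef φ l).isHermitian.apply, hyx, star_zero]
  · rw [if_neg (by tauto)]

lemma collisionPart_posSemidef (φ : Λ → EuclideanSpace ℂ α) (l : κ → Λ) :
    (collisionPart φ l).PosSemidef := by
  classical
  let D : Matrix (κ → α) (κ → α) ℂ :=
    Matrix.diagonal fun x => if Function.Injective x then 0 else 1
  convert (twirl_posSemidef φ l).mul_mul_conjTranspose_same D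
  ext x y
  by_cases hx : Function.Injective x <;> by_cases hy : Function.Injective y <;>
    simp [collisionPart, D, Matrix.diagonal_conjTranspose, hx, hy]

lemma trace_collisionPart [DecidableEq κ] {φ : Λ → EuclideanSpace ℂ α} (hφ : ∀ j, ‖φ j‖ = 1)
    (l : κ → Λ) : (collisionPart φ l).trace = 1 - injOverlap φ l l := by
  set N := (Fintype.card α).descFactorial (Fintype.card κ)
  have hdistinct : ∑ x : κ → α, (if Function.Injective x then twirl φ l x x else 0) =
      injOverlap φ l l :=
    calc ∑ x : κ → α, (if Function.Injective x then twirl φ l x x else 0)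
        = ∑ x : κ ↪ α, twirl φ l x x := by
          rw [← Finset.sum_filter, ← Finset.sum_subtype_eq_sum_filter, Finset.subtype_univ]
          exact Fintype.sum_equiv (Equiv.subtypeInjectiveEquivEmbedding κ α) _ _ fun x => rfl
      _ = N * (injOverlap φ l l / N) := by
          have hdiag (x : κ ↪ α) : twirl φ l x x = injOverlap φ l l / N :=
            twirl_apply_comp φ l x.injective 1
          rw [Finset.sum_congr rfl fun x _ => hdiag x, Finset.sum_const, Finset.card_univ,
            Fintype.card_embedding_eq, nsmul_eq_mul]
      _ = injOverlap φ l l := by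
          refine mul_div_cancel_of_imp' fun h => ?_
          have : IsEmpty (κ ↪ α) := by
            rw [← Fintype.card_eq_zero_iff, Fintype.card_embedding_eq]
            exact_mod_cast h
          rw [injOverlap, injSum_apply, Finset.univ_eq_empty, Finset.sum_empty]
  rw [← trace_twirl hφ l, ← hdistinct, Matrix.trace, Matrix.trace, ← Finset.sum_sub_distrib]
  refine Finset.sum_congr rfl fun x _ => ?_
  by_cases hx : Function.Injective x <;> simp [collisionPart, hx]

variable [DecidableEq κ]

lemma traceNorm_twirl {φ : Λ → EuclideanSpace ℂ α} (hφ : ∀ j, ‖φ j‖ = 1) (l : κ → Λ) :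
    traceNorm (twirl φ l) = 1 := by
  rw [traceNorm_of_posSemidef (twirl_posSemidef φ l), trace_twirl hφ, Complex.one_re]

lemma traceNorm_collisionPart_le {φ : Λ → EuclideanSpace ℂ α} (hφ : ∀ j, ‖φ j‖ = 1)
    (l : κ → Λ) : traceNorm (collisionPart φ l) ≤ ‖injOverlap φ l l - 1‖ := by
  rw [traceNorm_of_posSemidef (collisionPart_posSemidef φ l), trace_collisionPart hφ,
    norm_sub_rev]
  exact Complex.re_le_norm _

lemma traceNorm_smul_labelMatch_le (c : ℂ) (k l : κ → Λ) :
    traceNorm (c • labelMatch α k l) ≤ ‖c‖ :=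
  (traceNorm_smul_le _ _).trans
    (mul_le_of_le_one_right (norm_nonneg c) (traceNorm_labelMatch_le k l))

variable [Fintype Λ]

lemma twirl_sub_labelMatch [DecidableEq Λ] (φ : Λ → EuclideanSpace ℂ α) (l : κ → Λ) :
    twirl φ l - labelMatch α l l = collisionPart φ l + ((injOverlap φ l l - 1) • labelMatch α l l +
      ∑ k ∈ Finset.univ.erase l, injOverlap φ l k • labelMatch α k l) := by
  rw [twirl_eq_collisionPart_add_sum, ← Finset.add_sum_erase _ _ (Finset.mem_univ l), sub_smul,
    one_smul]
  abel

lemma traceNorm_twirl_sub_labelMatch_le {φ : Λ → EuclideanSpace ℂ α} (hφ : Orthonormal ℂ φ)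
    (l : κ → Λ) :
    traceNorm (twirl φ l - labelMatch α l l) ≤
      5 * (Fintype.card κ ^ 3 * Fintype.card Λ ^ 2 * maxProb φ) := by
  classical
  have hmax := maxProb_nonneg φ
  set b : ℝ := (Fintype.card κ : ℝ) ^ 3 * (Fintype.card Λ : ℝ) ^ 2 * maxProb φ with hb
  rcases lt_or_ge 1 b with hlarge | hsmall
  · linarith [traceNorm_sub_le (twirl φ l) (labelMatch α l l), traceNorm_twirl hφ.1 l,
      traceNorm_labelMatch_le (α := α) l l]
  have hdiag : (Fintype.card κ : ℝ) ^ 2 * maxProb φ ≤ b := by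
    rcases isEmpty_or_nonempty κ with hκ | ⟨⟨p₀⟩⟩
    · simp [hb]
    have hs : 1 ≤ Fintype.card Λ := Fintype.card_pos_iff.2 ⟨l p₀⟩
    have hms : Fintype.card κ ^ 2 ≤ Fintype.card κ ^ 3 * Fintype.card Λ ^ 2 :=
      (Nat.pow_le_pow_right (Fintype.card_pos_iff.2 ⟨p₀⟩) (by norm_num)).trans
        (Nat.le_mul_of_pos_right _ (by positivity))
    exact mul_le_mul_of_nonneg_right (by exact_mod_cast hms) hmax
  rw [twirl_sub_labelMatch]
  calc _ ≤ traceNorm (collisionPart φ l) + (traceNorm ((injOverlap φ l l - 1) • labelMatch α l l) +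
          traceNorm (∑ k ∈ Finset.univ.erase l, injOverlap φ l k • labelMatch α k l)) :=
        (traceNorm_add_le _ _).trans (add_le_add_right (traceNorm_add_le _ _) _)
    _ ≤ ‖injOverlap φ l l - 1‖ + (‖injOverlap φ l l - 1‖ +
          ∑ k ∈ Finset.univ.erase l, ‖injOverlap φ l k‖) := by
        gcongr
        · exact traceNorm_collisionPart_le hφ.1 l
        · exact traceNorm_smul_labelMatch_le _ l l
        · exact (traceNorm_sum_le _ _).trans
            (Finset.sum_le_sum fun k _ => traceNorm_smul_labelMatch_le _ k l)
    _ ≤ 5 * b := by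
        linarith [norm_injOverlap_self_sub_one_le hφ l, sum_norm_injOverlap_le hφ l hsmall]

end Twirl

section RandomSigns

variable {α : Type*} [Fintype α] [DecidableEq α]

lemma expect_exp_sum_sign_mul_le (b : α → ℝ) (r : ℝ) :
    𝔼 f : α → ℤˣ, Real.exp (r * ∑ y, ((f y : ℤ) : ℝ) * b y) ≤
      Real.exp (r ^ 2 * (∑ y, b y ^ 2) / 2) := by
  have hcosh (x : ℝ) : ∑ e : ℤˣ, Real.exp (((e : ℤ) : ℝ) * x) = 2 * Real.cosh x := by
    rw [UnitsInt.univ, Finset.sum_pair (by decide), Real.cosh_eq]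
    push_cast
    ring_nf
  have hprod (f : α → ℤˣ) : Real.exp (r * ∑ y, ((f y : ℤ) : ℝ) * b y) =
      ∏ y, Real.exp (((f y : ℤ) : ℝ) * (r * b y)) := by
    simp only [← Real.exp_sum, Finset.mul_sum, mul_left_comm]
  have hcard : (Fintype.card (α → ℤˣ) : ℝ) = 2 ^ Fintype.card α := by
    rw [Fintype.card_fun, Fintype.card_units_int]
    norm_num
  calc 𝔼 f : α → ℤˣ, Real.exp (r * ∑ y, ((f y : ℤ) : ℝ) * b y)
      = (∏ y, ∑ e : ℤˣ, Real.exp (((e : ℤ) : ℝ) * (r * b y))) / 2 ^ Fintype.card α := by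
        simp only [hprod]
        rw [Fintype.expect_eq_sum_div_card, hcard, Finset.prod_univ_sum, Fintype.piFinset_univ]
    _ = ∏ y, Real.cosh (r * b y) := by
        simp only [hcosh, Finset.prod_mul_distrib, Finset.prod_const, Finset.card_univ]
        exact mul_div_cancel_left₀ _ (by positivity)
    _ ≤ ∏ y, Real.exp ((r * b y) ^ 2 / 2) :=
        Finset.prod_le_prod (fun y _ => (Real.cosh_pos _).le)
          fun y _ => Real.cosh_le_exp_half_sq _
    _ = Real.exp (r ^ 2 * (∑ y, b y ^ 2) / 2) := by
        simp only [← Real.exp_sum, mul_pow, Finset.mul_sum, Finset.sum_div]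

lemma exp_le_exp_add_exp_neg {x c : ℝ} (h : c ^ 2 ≤ x ^ 2) :
    Real.exp c ≤ Real.exp x + Real.exp (-x) := by
  rcases le_abs.1 ((le_abs_self c).trans (sq_le_sq.1 h)) with h | h
  · linarith [Real.exp_le_exp.2 h, Real.exp_pos (-x)]
  · linarith [Real.exp_le_exp.2 h, Real.exp_pos x]

lemma expect_ite_lt_sum_sign_mul_sq_le {b : α → ℝ} {v K : ℝ} (hv : 0 < v) (hK : 0 ≤ K)
    (hb : ∑ y, b y ^ 2 ≤ v) :
    𝔼 f : α → ℤˣ, (if K * v < (∑ y, ((f y : ℤ) : ℝ) * b y) ^ 2 then (1 : ℝ) else 0) ≤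
      2 * Real.exp (-(K / 2)) := by
  -- Markov's inequality for the exponential moment at the optimal parameter `r = √(K / v)`.
  set r : ℝ := √(K / v)
  have hr : r ^ 2 = K / v := Real.sq_sqrt (by positivity)
  have hmarkov (z : ℝ) : (if K * v < z ^ 2 then (1 : ℝ) else 0) ≤
      Real.exp (-K) * (Real.exp (r * z) + Real.exp (-r * z)) := by
    split_ifs with hz
    · rw [Real.exp_neg, ← div_eq_inv_mul, one_le_div (Real.exp_pos _), neg_mul]
      refine exp_le_exp_add_exp_neg ?_
      calc K ^ 2 = K / v * (K * v) := by field_simp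
        _ ≤ (r * z) ^ 2 := by rw [mul_pow, hr]; gcongr
    · positivity
  have hmoment (q : ℝ) (hq : q ^ 2 = K / v) :
      𝔼 f : α → ℤˣ, Real.exp (q * ∑ y, ((f y : ℤ) : ℝ) * b y) ≤ Real.exp (K / 2) := by
    refine (expect_exp_sum_sign_mul_le b q).trans (Real.exp_le_exp.2 ?_)
    calc q ^ 2 * (∑ y, b y ^ 2) / 2 ≤ K / v * v / 2 := by rw [hq]; gcongr
      _ = K / 2 := by field_simp
  calc _ ≤ 𝔼 f : α → ℤˣ, Real.exp (-K) * (Real.exp (r * ∑ y, ((f y : ℤ) : ℝ) * b y) +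
          Real.exp (-r * ∑ y, ((f y : ℤ) : ℝ) * b y)) :=
        Finset.expect_le_expect fun f _ => hmarkov _
    _ ≤ Real.exp (-K) * (Real.exp (K / 2) + Real.exp (K / 2)) := by
        rw [← Finset.mul_expect, Finset.expect_add_distrib]
        gcongr
        exacts [hmoment r hr, hmoment (-r) (by rw [neg_sq, hr])]
    _ = 2 * Real.exp (-(K / 2)) := by
        rw [← two_mul, mul_left_comm, ← Real.exp_add]
        ring_nf

lemma expect_ite_lt_norm_sum_sign_mul_sq_le {a : α → ℂ} {v K : ℝ} (hv : 0 < v) (hK : 0 ≤ K)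
    (ha : ∑ y, ‖a y‖ ^ 2 ≤ v) :
    𝔼 f : α → ℤˣ, (if K * v < ‖∑ y, ((f y : ℤ) : ℂ) * a y‖ ^ 2 then (1 : ℝ) else 0) ≤
      4 * Real.exp (-(K / 4)) := by
  have hnorm (z : ℂ) : ‖z‖ ^ 2 = z.re ^ 2 + z.im ^ 2 := by
    rw [Complex.sq_norm, Complex.normSq_apply, sq, sq]
  have hre : ∑ y, (a y).re ^ 2 ≤ v :=
    (Finset.sum_le_sum fun y _ => by rw [hnorm]; linarith [sq_nonneg (a y).im]).trans ha
  have him : ∑ y, (a y).im ^ 2 ≤ v :=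
    (Finset.sum_le_sum fun y _ => by rw [hnorm]; linarith [sq_nonneg (a y).re]).trans ha
  have hsplit (f : α → ℤˣ) :
      (if K * v < ‖∑ y, ((f y : ℤ) : ℂ) * a y‖ ^ 2 then (1 : ℝ) else 0) ≤
        (if K / 2 * v < (∑ y, ((f y : ℤ) : ℝ) * (a y).re) ^ 2 then 1 else 0) +
          (if K / 2 * v < (∑ y, ((f y : ℤ) : ℝ) * (a y).im) ^ 2 then 1 else 0) := by
    have hsum : ‖∑ y, ((f y : ℤ) : ℂ) * a y‖ ^ 2 =
        (∑ y, ((f y : ℤ) : ℝ) * (a y).re) ^ 2 + (∑ y, ((f y : ℤ) : ℝ) * (a y).im) ^ 2 := by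
      rw [hnorm, Complex.re_sum, Complex.im_sum]
      simp
    split_ifs <;> linarith
  calc _ ≤ 2 * Real.exp (-(K / 2 / 2)) + 2 * Real.exp (-(K / 2 / 2)) := by
        refine (Finset.expect_le_expect fun f _ => hsplit f).trans ?_
        rw [Finset.expect_add_distrib]
        gcongr
        exacts [expect_ite_lt_sum_sign_mul_sq_le hv (by positivity) hre,
          expect_ite_lt_sum_sign_mul_sq_le hv (by positivity) him]
    _ = 4 * Real.exp (-(K / 4)) := by ring_nf

lemma expect_iSup_norm_sum_sign_mul_sq_le {ι : Type*} [Fintype ι] {a : ι → α → ℂ} {v K : ℝ}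
    (hv : 0 < v) (hK : 0 ≤ K) (ha : ∀ i, ∑ y, ‖a i y‖ ^ 2 ≤ v)
    (hle : ∀ (f : α → ℤˣ) (i : ι), ‖∑ y, ((f y : ℤ) : ℂ) * a i y‖ ^ 2 ≤ 1) :
    𝔼 f : α → ℤˣ, ⨆ i, ‖∑ y, ((f y : ℤ) : ℂ) * a i y‖ ^ 2 ≤
      K * v + Fintype.card ι * (4 * Real.exp (-(K / 4))) := by
  have hunion (f : α → ℤˣ) : ⨆ i, ‖∑ y, ((f y : ℤ) : ℂ) * a i y‖ ^ 2 ≤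
      K * v + ∑ i, if K * v < ‖∑ y, ((f y : ℤ) : ℂ) * a i y‖ ^ 2 then (1 : ℝ) else 0 := by
    have hind (i : ι) :
        (0 : ℝ) ≤ if K * v < ‖∑ y, ((f y : ℤ) : ℂ) * a i y‖ ^ 2 then 1 else 0 := by
      split_ifs <;> norm_num
    refine Real.iSup_le (fun i => ?_)
      (add_nonneg (by positivity) (Finset.sum_nonneg fun i _ => hind i))
    have hi := Finset.single_le_sum (fun i _ => hind i) (Finset.mem_univ i)
    have := hle f i
    split_ifs at hi <;> linarith [mul_nonneg hK hv.le]
  refine (Finset.expect_le_expect fun f _ => hunion f).trans ?_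
  rw [Finset.expect_add_distrib, Fintype.expect_const, Finset.expect_sum_comm]
  gcongr
  exact (Finset.sum_le_card_nsmul _ _ _ fun i _ =>
    expect_ite_lt_norm_sum_sign_mul_sq_le hv hK (ha i)).trans_eq (by simp)

end RandomSigns

section Tensor

variable {κ α : Type*} [Fintype κ]

lemma tensor_mul [DecidableEq κ] [Fintype α] (A B : κ → Matrix α α ℂ) :
    tensor A * tensor B = tensor fun p => A p * B p := by
  ext x y
  simp only [tensor, Matrix.mul_apply, Matrix.of_apply, ← Finset.prod_mul_distrib]
  rw [Finset.prod_univ_sum, Fintype.piFinset_univ]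

lemma conjTranspose_tensor (A : κ → Matrix α α ℂ) : (tensor A)ᴴ = tensor fun p => (A p)ᴴ := by
  ext x y
  simp [tensor, Matrix.conjTranspose_apply]

lemma tensor_one [DecidableEq α] :
    tensor (fun _ : κ => (1 : Matrix α α ℂ)) = 1 := by
  classical
  ext x y
  simp only [tensor, Matrix.of_apply, Matrix.one_apply]
  rw [Finset.prod_ite_zero]
  simp [funext_iff]

end Tensor

section Circuit

variable {n : ℕ}

lemma norm_sq_hadamard (a b : Bool) : ‖hadamard a b‖ ^ 2 = 1 / 2 := by
  rw [hadamard, Matrix.of_apply, norm_div, Complex.norm_real, div_pow]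
  split_ifs <;> simp

lemma conjTranspose_hadamard_mul_self : hadamardᴴ * hadamard = 1 := by
  have hsqrt : (Real.sqrt 2 : ℂ) * (Real.sqrt 2 : ℂ) = 2 := by
    exact_mod_cast congrArg Complex.ofReal (Real.mul_self_sqrt zero_le_two)
  ext a b
  cases a <;> cases b <;>
    norm_num [Matrix.mul_apply, Matrix.conjTranspose_apply, hadamard, neg_div, hsqrt, ← mul_inv]

/-- The Hadamard transform `H^{⊗n}` of `n` qubits. -/
def walsh (n : ℕ) : Matrix (Bits n) (Bits n) ℂ :=
  tensor fun _ : Fin n => hadamard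

lemma conjTranspose_walsh_mul_self : (walsh n)ᴴ * walsh n = 1 := by
  rw [walsh, conjTranspose_tensor, tensor_mul]
  simp only [conjTranspose_hadamard_mul_self, tensor_one]

lemma norm_sq_walsh (x y : Bits n) : ‖walsh n x y‖ ^ 2 = 1 / 2 ^ n := by
  simp [walsh, tensor, norm_prod, ← Finset.prod_pow, norm_sq_hadamard]

variable {Λ : Type*}

/-- The states `H^{⊗n} U_f |ψ j⟩`. -/
def spread (ψ : Λ → EuclideanSpace ℂ (Bits n)) (f : Bits n → ℤˣ) (j : Λ) :
    EuclideanSpace ℂ (Bits n) :=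
  WithLp.toLp 2 (walsh n *ᵥ fun y => ((f y : ℤ) : ℂ) * ψ j y)

lemma spread_apply (ψ : Λ → EuclideanSpace ℂ (Bits n)) (f : Bits n → ℤˣ) (j : Λ) (x : Bits n) :
    spread ψ f j x = ∑ y, ((f y : ℤ) : ℂ) * (walsh n x y * ψ j y) :=
  Finset.sum_congr rfl fun _ _ => mul_left_comm _ _ _

lemma inner_spread (ψ : Λ → EuclideanSpace ℂ (Bits n)) (f : Bits n → ℤˣ) (j k : Λ) :
    inner ℂ (spread ψ f j) (spread ψ f k) = inner ℂ (ψ j) (ψ k) := by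
  have hsign (y : Bits n) : ((f y : ℤ) : ℂ) * ((f y : ℤ) : ℂ) = 1 := by
    exact_mod_cast Int.units_coe_mul_self (f y)
  rw [spread, spread, EuclideanSpace.inner_toLp_toLp, dotProduct_comm, Matrix.star_mulVec,
    ← Matrix.dotProduct_mulVec, Matrix.mulVec_mulVec, conjTranspose_walsh_mul_self,
    Matrix.one_mulVec, PiLp.inner_apply, dotProduct]
  refine Finset.sum_congr rfl fun y _ => ?_
  rw [Pi.star_apply, star_mul', star_intCast, mul_mul_mul_comm, hsign, one_mul, mul_comm]
  rfl

lemma orthonormal_spread {ψ : Λ → EuclideanSpace ℂ (Bits n)} (hψ : Orthonormal ℂ ψ)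
    (f : Bits n → ℤˣ) : Orthonormal ℂ (spread ψ f) := by
  classical
  rw [orthonormal_iff_ite] at hψ ⊢
  simpa only [inner_spread] using hψ

lemma permU_mulVec (π : Equiv.Perm (Bits n)) (v : Bits n → ℂ) (x : Bits n) :
    (permU π *ᵥ v) x = v (π.symm x) := by
  rw [permU, Matrix.sum_mulVec, Finset.sum_apply, Finset.sum_eq_single (π.symm x)]
  · simp [Matrix.single_mulVec, Function.update]
  · intro b _ hb
    have : x ≠ π b := fun h => hb (by simp [h])
    simp [Matrix.single_mulVec, Function.update, this]
  · simp

lemma circuitU_mulVec (f g : Bits n → ℤˣ) (π : Equiv.Perm (Bits n))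
    (ψ : Λ → EuclideanSpace ℂ (Bits n)) (j : Λ) (x : Bits n) :
    (circuitU f g π *ᵥ ψ j) x = ((g (π.symm x) : ℤ) : ℂ) * spread ψ f j (π.symm x) := by
  have hphase : phaseU f *ᵥ ψ j = fun y => ((f y : ℤ) : ℂ) * ψ j y :=
    funext fun y => Matrix.mulVec_diagonal _ _ y
  rw [circuitU, ← Matrix.mulVec_mulVec, ← Matrix.mulVec_mulVec, ← Matrix.mulVec_mulVec,
    permU_mulVec, phaseU, Matrix.mulVec_diagonal, hphase]
  rfl

lemma circuitU_mul_ketbra_mul (f g : Bits n → ℤˣ) (π : Equiv.Perm (Bits n))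
    (ψ : EuclideanSpace ℂ (Bits n)) :
    circuitU f g π * ketbra ψ * (circuitU f g π)ᴴ =
      Matrix.vecMulVec (circuitU f g π *ᵥ ψ) (star (circuitU f g π *ᵥ ψ)) := by
  rw [Matrix.star_mulVec, ← Matrix.vecMulVec_mul, ← Matrix.mul_vecMulVec]
  rfl

variable {s : ℕ}

lemma outputState_eq_expect_twirl (t : ℕ) (ψ : Fin s → EuclideanSpace ℂ (Bits n)) :
    outputState t ψ =
      𝔼 f : Bits n → ℤˣ, twirl (spread ψ f) (Prod.fst : Fin s × Fin t → Fin s) := by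
  refine Finset.expect_congr rfl fun f _ => Finset.expect_congr rfl fun g _ =>
    Finset.expect_congr rfl fun π _ => ?_
  rw [inputState, tensor_mul, tensor_mul]
  ext x y
  simp only [circuitU_mul_ketbra_mul, tensor, Matrix.of_apply, Matrix.vecMulVec_apply,
    Pi.star_apply, circuitU_mulVec, ← Finset.prod_mul_distrib, twirlVec, star_prod]

end Circuit

section RhoUni

lemma exists_eq_prodCongrRight {ι τ : Type*} [Finite τ] {σ : Equiv.Perm (ι × τ)}
    (h : Prod.fst ∘ σ = Prod.fst) : ∃ ρ : ι → Equiv.Perm τ, σ = Equiv.prodCongrRight ρ := by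
  have hfst (j : ι) (i : τ) : (σ (j, i)).1 = j := congrFun h (j, i)
  have hinj (j : ι) : Function.Injective fun i => (σ (j, i)).2 := fun i i' hi =>
    (Prod.mk.inj (σ.injective (Prod.ext ((hfst j i).trans (hfst j i').symm) hi))).2
  refine ⟨fun j => Equiv.ofBijective _ (Finite.injective_iff_bijective.1 (hinj j)), ?_⟩
  ext ⟨j, i⟩
  · simp [hfst]
  · simp

open Classical in
lemma rhoUni_apply (n s t : ℕ) (x y : Fin s × Fin t → Bits n) :
    rhoUni n s t x y = if Function.Injective x ∧
        ∃ ρ : Fin s → Equiv.Perm (Fin t), y = x ∘ Equiv.prodCongrRight ρ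
      then ((2 ^ n).descFactorial (s * t) : ℂ)⁻¹ else 0 := by
  rw [rhoUni, Matrix.smul_apply, one_div, Matrix.sum_apply]
  simp only [Matrix.sum_apply, Matrix.single_apply]
  split_ifs with h
  · obtain ⟨hx, ρ, rfl⟩ := h
    rw [Finset.sum_eq_single ⟨x, hx⟩, Finset.sum_eq_single ρ]
    · simp [Function.comp_def]
    · refine fun ρ' _ hne => if_neg fun h : _ ∧ _ => hne (funext fun j => Equiv.ext fun i => ?_)
      exact (Prod.mk.inj (hx (congrFun h.2 (j, i)))).2
    · simp
    · exact fun z _ hz => Finset.sum_eq_zero fun ρ _ => if_neg fun h : _ ∧ _ =>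
        hz (DFunLike.coe_injective h.1)
    · simp
  · refine smul_eq_zero_of_right _ (Finset.sum_eq_zero fun z _ => Finset.sum_eq_zero fun ρ _ => ?_)
    refine if_neg fun hz : _ ∧ _ => h ?_
    obtain ⟨rfl, rfl⟩ := hz
    exact ⟨z.injective, ρ, rfl⟩

lemma rhoUni_eq_labelMatch (n s t : ℕ) :
    rhoUni n s t = labelMatch (Bits n) (Prod.fst : Fin s × Fin t → Fin s) Prod.fst := by
  classical
  ext x y
  rw [rhoUni_apply]
  by_cases hx : Function.Injective x
  swap
  · rw [labelMatch_apply_of_not_injective _ _ hx, if_neg fun h => hx h.1]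
  by_cases hy : ∃ σ : Equiv.Perm (Fin s × Fin t), y = x ∘ σ
  swap
  · rw [labelMatch_apply_of_not_perm _ _ hy, if_neg fun ⟨_, ρ, h⟩ => hy ⟨_, h⟩]
  obtain ⟨σ, rfl⟩ := hy
  have hblock : (Function.Injective x ∧ ∃ ρ : Fin s → Equiv.Perm (Fin t),
      x ∘ σ = x ∘ Equiv.prodCongrRight ρ) ↔ (Prod.fst : Fin s × Fin t → Fin s) =
        Prod.fst ∘ σ.symm := by
    rw [Equiv.eq_comp_symm]
    refine ⟨fun ⟨_, ρ, h⟩ => ?_, fun h => ?_⟩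
    · rw [DFunLike.coe_injective (hx.comp_left h)]
      rfl
    · obtain ⟨ρ, rfl⟩ := exists_eq_prodCongrRight h
      exact ⟨hx, ρ, rfl⟩
  rw [labelMatch_apply_comp _ _ hx]
  simp only [hblock, Fintype.card_fun, Fintype.card_bool, Fintype.card_prod, Fintype.card_fin]

end RhoUni

section Conclusion

variable {n : ℕ}

lemma expect_maxProb_spread_le {Λ : Type*} [Finite Λ] {ψ : Λ → EuclideanSpace ℂ (Bits n)}
    (hψ : Orthonormal ℂ ψ) (hn : 1 ≤ n) :
    𝔼 f : Bits n → ℤˣ, maxProb (spread ψ f) ≤ 16 * (n / 2 ^ n) := by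
  have := Fintype.ofFinite Λ
  have hcard : (Fintype.card Λ : ℝ) ≤ 2 ^ n := by
    have h := hψ.linearIndependent.fintype_card_le_finrank
    rw [finrank_euclideanSpace, Fintype.card_fun, Fintype.card_bool, Fintype.card_fin] at h
    exact_mod_cast h
  have hvariance (p : Λ × Bits n) : ∑ y, ‖walsh n p.2 y * ψ p.1 y‖ ^ 2 ≤ (1 / 2 ^ n : ℝ) := by
    simp only [norm_mul, mul_pow, norm_sq_walsh]
    rw [← Finset.mul_sum, ← EuclideanSpace.norm_sq_eq, hψ.1 p.1, one_pow, mul_one]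
  have hle (f : Bits n → ℤˣ) (p : Λ × Bits n) :
      ‖∑ y, ((f y : ℤ) : ℂ) * (walsh n p.2 y * ψ p.1 y)‖ ^ 2 ≤ 1 := by
    rw [← spread_apply, sq_le_one_iff₀ (norm_nonneg _), ← (orthonormal_spread hψ f).1 p.1]
    exact PiLp.norm_apply_le _ _
  have hexp : Real.exp (-(12 * n / 4)) ≤ ((2 ^ n : ℝ) ^ 3)⁻¹ := by
    rw [Real.exp_neg, show (12 * n / 4 : ℝ) = (n * 3 : ℕ) * 1 by push_cast; ring,
      Real.exp_nat_mul, ← pow_mul]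
    have := Real.exp_one_gt_two
    gcongr
  calc 𝔼 f : Bits n → ℤˣ, maxProb (spread ψ f)
      ≤ 12 * n * (1 / 2 ^ n) +
          Fintype.card (Λ × Bits n) * (4 * Real.exp (-(12 * n / 4))) := by
        simp only [maxProb, spread_apply]
        exact expect_iSup_norm_sum_sign_mul_sq_le (by positivity) (by positivity) hvariance hle
    _ ≤ 12 * n * (1 / 2 ^ n) + 2 ^ n * 2 ^ n * (4 * ((2 ^ n : ℝ) ^ 3)⁻¹) := by
        simp only [Fintype.card_prod, Fintype.card_fun, Fintype.card_bool, Fintype.card_fin,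
          Nat.cast_mul, Nat.cast_pow, Nat.cast_ofNat]
        gcongr
    _ = (12 * n + 4 * 1) / 2 ^ n := by field_simp
    _ ≤ (12 * n + 4 * n) / 2 ^ n := by gcongr; exact_mod_cast hn
    _ = 16 * (n / 2 ^ n) := by ring

lemma traceNorm_outputState_sub_rhoUni_le {s : ℕ} (t : ℕ) (hn : 1 ≤ n)
    {ψ : Fin s → EuclideanSpace ℂ (Bits n)} (hψ : Orthonormal ℂ ψ) :
    traceNorm (outputState t ψ - rhoUni n s t) ≤
      80 * ((s : ℝ) ^ 5 * (t : ℝ) ^ 3 * n / 2 ^ n) := by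
  have hsub : outputState t ψ - rhoUni n s t = 𝔼 f : Bits n → ℤˣ,
      (twirl (spread ψ f) (Prod.fst : Fin s × Fin t → Fin s) -
        labelMatch (Bits n) Prod.fst Prod.fst) := by
    rw [Finset.expect_sub_distrib, Fintype.expect_const, outputState_eq_expect_twirl,
      rhoUni_eq_labelMatch]
  calc traceNorm (outputState t ψ - rhoUni n s t)
      ≤ 𝔼 f : Bits n → ℤˣ, 5 * (((s * t : ℕ) : ℝ) ^ 3 * (s : ℝ) ^ 2 * maxProb (spread ψ f)) := by
        rw [hsub]
        refine (traceNorm_expect_le _).trans (Finset.expect_le_expect fun f _ => ?_)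
        simpa only [Fintype.card_prod, Fintype.card_fin] using
          traceNorm_twirl_sub_labelMatch_le (orthonormal_spread hψ f)
            (Prod.fst : Fin s × Fin t → Fin s)
    _ ≤ 5 * (((s * t : ℕ) : ℝ) ^ 3 * (s : ℝ) ^ 2 * (16 * (n / 2 ^ n))) := by
        rw [← Finset.mul_expect, ← Finset.mul_expect]
        gcongr
        exact expect_maxProb_spread_le hψ hn
    _ = 80 * ((s : ℝ) ^ 5 * (t : ℝ) ^ 3 * n / 2 ^ n) := by push_cast; ring

end Conclusion

end OrthPRU

end

theorem lemma4p1 :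
    ∃ C : ℝ, ∀ (n s t : ℕ), 1 ≤ n →
      ∀ ψ : Fin s → EuclideanSpace ℂ (OrthPRU.Bits n), Orthonormal ℂ ψ →
        OrthPRU.traceNorm (OrthPRU.outputState t ψ - OrthPRU.rhoUni n s t) ≤
          C * ((s : ℝ) ^ 6 * (t : ℝ) ^ 4 * (n : ℝ) ^ 2 / 2 ^ n) := by
  refine ⟨80, fun n s t hn ψ hψ => (OrthPRU.traceNorm_outputState_sub_rhoUni_le t hn hψ).trans ?_⟩
  have hsq (a : ℕ) : (a : ℝ) ≤ (a : ℝ) ^ 2 := by exact_mod_cast Nat.le_self_pow two_ne_zero a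
  gcongr 80 * (?_ / _)
  calc (s : ℝ) ^ 5 * (t : ℝ) ^ 3 * n = (s : ℝ) ^ 4 * s * ((t : ℝ) ^ 2 * t) * n := by ring
    _ ≤ (s : ℝ) ^ 4 * (s : ℝ) ^ 2 * ((t : ℝ) ^ 2 * (t : ℝ) ^ 2) * (n : ℝ) ^ 2 := by
      gcongr <;> exact hsq _
    _ = (s : ℝ) ^ 6 * (t : ℝ) ^ 4 * (n : ℝ) ^ 2 := by ring
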